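/- Let $K$ be an algebraically closed field that is complete with respect to a nontrivial non-Archimedean absolute value $|\cdot|$. Give $\mathbb{P}^1(K)$ the topology generated by the open balls $\{x\in K:|x-a|<r\}$ and the complements $\mathbb{P}^1(K)\setminus\{x\in K:|x-a|\le r\}$ of closed balls ($a\in K$, $r>0$). A $2\times 2$ matrix is hyperbolic if it has two eigenvalues with different absolute values. Let $\Gamma\le PGL(2,K)$ be a Schottky group, i.e. a finitely generated subgroup in which every non-identity element is hyperbolic, acting on $\mathbb{P}^1(K)$ in the usual way. Let $\Sigma\subset\mathbb{P}^1(K)$ (the set of bad points) be the set of fixed points of non-identity elements of $\Gamma$ together with the limit points of the set of these fixed points. In the analytic projective line $(\mathbb{P}^1)^{an}$, whose points are the points of $\mathbb{P}^1(K)$ (type 1), the closed balls $B(c,t)^+=\{x\in K:|x-c|\le t\}$ with $c\in K$, $t>0$ (types 2 and 3), and the equivalence classes of nested sequences of closed balls with empty intersection (type 4), the path connecting two distinct type 1 points $x,y$ consists of $x$, $y$ and, if $x,y\in K$, of all $B(x,t)^+$ and $B(y,t)^+$ with $0<t\le|x-y|$, respectively, if one of the two points is $\infty$ and the other is $c\in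 K$, of all $B(c,t)^+$ with $t>0$; the path from a type 1 point to itself is that point. For $S\subset\mathbb{P}^1(K)$, the subtree $T(S)$ of $(\mathbb{P}^1)^{an}$ spanned by $S$ is the union of all paths connecting pairs of points of $S$, where the type 1 points (the ends of the tree, at infinite distance) are not counted as points of the tree. Let $a\in K$, and assume that $\Gamma$ is not abelian (for a free group $\Gamma$ this means rank $g\ge 2$) or that $a\notin\Sigma$. Then $T(\Gamma a)\supset T(\Sigma)$. Furthermore, if $a\in\Sigma$, then $T(\Gamma a)=T(\Sigma)$. -/

import Mathlib

open scoped LinearAlgebra.Projectivization MatrixGroups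

noncomputable section

namespace Mumford

variable (K : Type*) [NontriviallyNormedField K]

/-- The projective line `ℙ¹(K)`. The group `PGL(2, K)` acts on it through column vectors. -/
abbrev P1 : Type _ := ℙ K (Fin 2 → K)

variable {K}

/-- The affine point `a = (a : 1)`. -/
def affinePt (a : K) : P1 K :=
  Projectivization.mk K ![a, 1] (by simp)

variable (K) in
/-- The point at infinity `∞ = (1 : 0)`. -/
def inftyPt : P1 K :=
  Projectivization.mk K ![1, 0] (by simp)

/-- Open balls in `ℙ¹(K)`: the usual open balls, and the complements of the usual closed balls. -/
def IsOpenBallP1 (U : Set (P1 K)) : Prop :=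
  ∃ (a : K) (r : ℝ), 0 < r ∧
    (U = affinePt '' Metric.ball a r ∨ U = (affinePt '' Metric.closedBall a r)ᶜ)

variable (K) in
/-- The topology of `ℙ¹(K)`, generated by the open balls. -/
abbrev topologyP1 : TopologicalSpace (P1 K) :=
  TopologicalSpace.generateFrom {U | IsOpenBallP1 U}

/-- A `2 × 2` matrix is hyperbolic if it has two eigenvalues with different valuations. -/
def IsHyperbolicMatrix (A : Matrix (Fin 2) (Fin 2) K) : Prop :=
  ∃ l m : K, Module.End.HasEigenvalue (Matrix.toLin' A) l ∧
    Module.End.HasEigenvalue (Matrix.toLin' A) m ∧ ‖l‖ ≠ ‖m‖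

/-- An element of `PGL(2, K)` is hyperbolic if a matrix representing it is hyperbolic
(this does not depend on the representative). -/
def IsHyperbolic (g : PGL(2, K)) : Prop :=
  ∃ A : GL (Fin 2) K, Matrix.ProjGenLinGroup.mk A = g ∧
    IsHyperbolicMatrix (A : Matrix (Fin 2) (Fin 2) K)

/-- A Schottky group is a finitely generated subgroup of `PGL(2, K)` all of whose non-identity
elements are hyperbolic. -/
def IsSchottky (G : Subgroup PGL(2, K)) : Prop :=
  G.FG ∧ ∀ g ∈ G, g ≠ 1 → IsHyperbolic g

/-- The fixed points in `ℙ¹(K)` of the non-identity elements of `G`. -/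
def fixedPts (G : Subgroup PGL(2, K)) : Set (P1 K) :=
  {x | ∃ g ∈ G, g ≠ 1 ∧ g • x = x}

/-- The set `Σ` of bad points: the fixed points of non-identity elements, and the limit points
of the set of these fixed points. -/
def badPts (G : Subgroup PGL(2, K)) : Set (P1 K) :=
  fixedPts G ∪ @derivedSet (P1 K) (topologyP1 K) (fixedPts G)

/-! ### The analytic projective line -/

variable (K) in
/-- The closed balls `B(a, r)⁺` of `K` with `r > 0`, as subsets of `K`. -/
def ClosedBall : Type _ :=
  {B : Set K // ∃ (a : K) (r : ℝ), 0 < r ∧ B = Metric.closedBall a r}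

/-- The closed ball `B(a, r)⁺`. -/
def ClosedBall.mk (a : K) (r : ℝ) (hr : 0 < r) : ClosedBall K :=
  ⟨Metric.closedBall a r, a, r, hr, rfl⟩

variable (K) in
/-- Decreasing sequences of closed balls with empty intersection. -/
structure NestedBalls where
  /-- The sequence of balls. -/
  seq : ℕ → ClosedBall K
  anti : ∀ n, (seq (n + 1)).1 ⊆ (seq n).1
  inter_eq_empty : ⋂ n, (seq n).1 = ∅

variable (K) in
/-- Two nested sequences are equivalent if each ball of either one contains a ball of the
other one. -/
def NestedBalls.setoid : Setoid (NestedBalls K) where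
  r S T := (∀ n, ∃ m, (T.seq m).1 ⊆ (S.seq n).1) ∧ (∀ n, ∃ m, (S.seq m).1 ⊆ (T.seq n).1)
  iseqv :=
    { refl := fun _ => ⟨fun n => ⟨n, subset_rfl⟩, fun n => ⟨n, subset_rfl⟩⟩
      symm := fun h => ⟨h.2, h.1⟩
      trans := fun {S T U} h₁ h₂ => by
        refine ⟨fun n => ?_, fun n => ?_⟩
        · obtain ⟨m, hm⟩ := h₁.1 n
          obtain ⟨k, hk⟩ := h₂.1 m
          exact ⟨k, hk.trans hm⟩
        · obtain ⟨m, hm⟩ := h₂.2 n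
          obtain ⟨k, hk⟩ := h₁.2 m
          exact ⟨k, hk.trans hm⟩ }

variable (K) in
/-- The points of the analytic projective line `(ℙ¹)ᵃⁿ` (for algebraically closed complete `K`).
* Type 1: the points of `ℙ¹(K)`.
* Types 2 and 3: the closed balls `B(a, r)⁺`, with `r ∈ |Kˣ|` (type 2) or `r ∉ |Kˣ|` (type 3).
* Type 4: equivalence classes of nested sequences of closed balls with empty intersection. -/
inductive P1an : Type _
  | typeOne (x : P1 K) : P1an
  | ofBall (B : ClosedBall K) : P1an
  | typeFour (q : Quotient (NestedBalls.setoid K)) : P1an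

/-- The point of `(ℙ¹)ᵃⁿ` corresponding to `B(a, r)⁺`. -/
def ballPt (a : K) (r : ℝ) (hr : 0 < r) : P1an K :=
  P1an.ofBall (ClosedBall.mk a r hr)

/-- The half-open segment of the points `B(a, t)⁺` with `0 < t ≤ r`, going from the smallest balls
around `a` (the end `a` is not included) up to `B(a, r)⁺`. It is empty for `r = 0`. -/
def segmentUpTo (a : K) (r : ℝ) : Set (P1an K) :=
  {P | ∃ (t : ℝ) (ht : 0 < t), t ≤ r ∧ P = ballPt a t ht}

/-- The open ray of all points `B(a, t)⁺` with `t > 0`, joining `a` to `∞`. -/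
def openRay (a : K) : Set (P1an K) :=
  {P | ∃ (t : ℝ) (ht : 0 < t), P = ballPt a t ht}

/-- The path in `(ℙ¹)ᵃⁿ` connecting the type 1 points `x` and `y`, including these two ends.
* For `x = a` and `y = b` in `K`: it goes up from `a` along the balls around `a` to `B(a, |a - b|)⁺`,
  which is the smallest closed ball that contains both, and down along the balls around `b`.
* For `x = a` in `K` and `y = ∞` (or conversely): it passes through all closed balls around `a`.
* If `x = y`, it is the single point `x`. -/
def path (x y : P1 K) : Set (P1an K) :=
  {P | P = P1an.typeOne x ∨ P = P1an.typeOne y ∨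
    (∃ a b : K, x = affinePt a ∧ y = affinePt b ∧
      P ∈ segmentUpTo a ‖a - b‖ ∪ segmentUpTo b ‖a - b‖) ∨
    (∃ a : K, x = affinePt a ∧ y = inftyPt K ∧ P ∈ openRay a) ∨
    (∃ b : K, x = inftyPt K ∧ y = affinePt b ∧ P ∈ openRay b)}

/-- The subtree `T(S)` of `(ℙ¹)ᵃⁿ` spanned by `S ⊆ ℙ¹(K)`: the union of all paths connecting pairs
of points of `S`, where the type 1 points (which lie at infinite distance and are the ends of the
tree) are not counted as points of the tree. -/
def spannedSubtree (S : Set (P1 K)) : Set (P1an K) :=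
  (⋃ x ∈ S, ⋃ y ∈ S, path x y) \ Set.range P1an.typeOne

end Mumford

end

/-! A ball point of radius `t` about `a` lies on `T(S)` once `S` has points both inside and outside
the open ball of radius `t` about `a`. In an ultrametric both conditions are open, so points of `S`
can be replaced by nearby points of another set: `S ⊆ closure T` implies `T(S) ⊆ T(T)`
(`spannedSubtree_subset_of_subset_closure`). The inclusion thus reduces to `Σ ⊆ closure (Γa)`
(`badPts_subset_closure_orbit`). Powers of a hyperbolic element bring every point but one
arbitrarily near to a given fixed point, so the orbit accumulates there unless it consists of the
exceptional point alone. In that case `Γ` fixes `a`, hence is abelian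
(`IsSchottky.commute_of_forall_smul_eq`), and `a ∈ Σ`, contrary to the assumption. If `a ∈ Σ`,
equality follows since `Σ` is `Γ`-invariant (`smul_mem_badPts`) and `T` is monotone. -/

namespace Mumford

/-! ### The topology of the projective line and continuity of the action. -/

section Topology

variable {K : Type*} [NontriviallyNormedField K]

theorem mk_eq_affinePt_iff {v : Fin 2 → K} (hv : v ≠ 0) {z : K} :
    affinePt z = Projectivization.mk K v hv ↔ v 1 ≠ 0 ∧ v 0 = z * v 1 := by
  rw [affinePt, Projectivization.mk_eq_mk_iff']
  constructor
  · rintro ⟨t, ht⟩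
    have h0 : t * v 0 = z := by simpa using congrFun ht 0
    have h1 : t * v 1 = 1 := by simpa using congrFun ht 1
    refine ⟨right_ne_zero_of_mul_eq_one h1, ?_⟩
    rw [← h0, mul_right_comm, h1, one_mul]
  · rintro ⟨h1, h0⟩
    refine ⟨(v 1)⁻¹, ?_⟩
    ext i
    fin_cases i
    · simp [h0]
      field_simp
    · simp [h1]

theorem eq_inftyPt_or_eq_affinePt (x : P1 K) : x = inftyPt K ∨ ∃ z : K, x = affinePt z := by
  induction x using Projectivization.ind with | h v hv =>
  by_cases h1 : v 1 = 0
  · left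
    rw [inftyPt, Projectivization.mk_eq_mk_iff']
    refine ⟨v 0, ?_⟩
    ext i
    fin_cases i <;> simp [h1]
  · right
    exact ⟨v 0 / v 1, ((mk_eq_affinePt_iff hv).2 ⟨h1, by field_simp⟩).symm⟩

theorem inftyPt_ne_affinePt (z : K) : inftyPt K ≠ affinePt z := fun h => by
  have := (mk_eq_affinePt_iff _).1 h.symm
  simp at this

theorem affinePt_injective : Function.Injective (affinePt : K → P1 K) := fun z w h => by
  have := ((mk_eq_affinePt_iff (by simp)).1 h).2
  simpa using this.symm

theorem isOpen_image_ball (a : K) {r : ℝ} (hr : 0 < r) :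
    @IsOpen _ (topologyP1 K) (affinePt '' Metric.ball a r) :=
  TopologicalSpace.isOpen_generateFrom_of_mem ⟨a, r, hr, Or.inl rfl⟩

theorem isOpen_compl_image_closedBall (a : K) {r : ℝ} (hr : 0 < r) :
    @IsOpen _ (topologyP1 K) (affinePt '' Metric.closedBall a r)ᶜ :=
  TopologicalSpace.isOpen_generateFrom_of_mem ⟨a, r, hr, Or.inr rfl⟩

/-- Clearing the denominator gives a strict inequality between continuous functions of the vector,
valid also at infinity, where `v.1 1 = 0`. Preimages of balls are therefore open. -/
theorem mk_mem_image_ball_iff (v : {v : Fin 2 → K // v ≠ 0}) (a : K) (r : ℝ) :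
    Projectivization.mk' K v ∈ affinePt '' Metric.ball a r ↔
      ‖v.1 0 - a * v.1 1‖ < r * ‖v.1 1‖ := by
  rw [Projectivization.mk'_eq_mk]
  constructor
  · rintro ⟨z, hz, h⟩
    obtain ⟨h1, h0⟩ := (mk_eq_affinePt_iff v.2).1 h
    rw [h0, ← sub_mul, norm_mul]
    exact mul_lt_mul_of_pos_right (by simpa [dist_eq_norm] using hz) (norm_pos_iff.2 h1)
  · intro h
    have h1 : v.1 1 ≠ 0 := fun h1 => by
      simp only [h1, norm_zero, mul_zero] at h
      exact (norm_nonneg _).not_gt h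
    refine ⟨v.1 0 / v.1 1, ?_, (mk_eq_affinePt_iff v.2).2 ⟨h1, by field_simp⟩⟩
    rw [Metric.mem_ball, dist_eq_norm]
    have : v.1 0 / v.1 1 - a = (v.1 0 - a * v.1 1) / v.1 1 := by field_simp
    rw [this, norm_div]
    exact (div_lt_iff₀ (norm_pos_iff.2 h1)).2 h

theorem mk_mem_compl_image_closedBall_iff (v : {v : Fin 2 → K // v ≠ 0}) (a : K) (r : ℝ) :
    Projectivization.mk' K v ∈ (affinePt '' Metric.closedBall a r)ᶜ ↔
      r * ‖v.1 1‖ < ‖v.1 0 - a * v.1 1‖ := by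
  rw [← not_le, Set.mem_compl_iff, not_iff_not, Projectivization.mk'_eq_mk]
  constructor
  · rintro ⟨z, hz, h⟩
    obtain ⟨h1, h0⟩ := (mk_eq_affinePt_iff v.2).1 h
    rw [h0, ← sub_mul, norm_mul]
    exact mul_le_mul_of_nonneg_right (by simpa [dist_eq_norm] using hz) (norm_nonneg _)
  · intro h
    have h1 : v.1 1 ≠ 0 := fun h1 => by
      simp only [h1, norm_zero, mul_zero, sub_zero, norm_le_zero_iff] at h
      refine v.2 (funext fun i => ?_)
      fin_cases i
      exacts [h, h1]
    refine ⟨v.1 0 / v.1 1, ?_, (mk_eq_affinePt_iff v.2).2 ⟨h1, by field_simp⟩⟩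
    rw [Metric.mem_closedBall, dist_eq_norm]
    have : v.1 0 / v.1 1 - a = (v.1 0 - a * v.1 1) / v.1 1 := by field_simp
    rw [this, norm_div]
    exact (div_le_iff₀ (norm_pos_iff.2 h1)).2 h

variable (K) in
/-- The topology generated by the open balls is the quotient topology. -/
theorem topologyP1_eq_coinduced :
    topologyP1 K = TopologicalSpace.coinduced (Projectivization.mk' K) inferInstance := by
  refine le_antisymm (fun U hU => ?_) (le_generateFrom ?_)
  · have hU' : IsOpen (Projectivization.mk' K ⁻¹' U) := hU
    refine (@isOpen_iff_forall_mem_open _ (topologyP1 K) _).2 fun x hx => ?_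
    rcases eq_inftyPt_or_eq_affinePt x with rfl | ⟨b, rfl⟩
    -- Near infinity the chart is `w ↦ (1 : w)` with `w = z⁻¹`, so `‖w‖ < ε` becomes `‖z‖ > ε⁻¹`.
    · have hc : Continuous fun w : K =>
          (⟨![1, w], by simp⟩ : {v : Fin 2 → K // v ≠ 0}) := by
        refine Continuous.subtype_mk (continuous_pi fun i => ?_) _
        fin_cases i
        exacts [continuous_const, continuous_id]
      obtain ⟨ε, hε, hb⟩ := Metric.isOpen_iff.1 (hU'.preimage hc) 0 hx
      refine ⟨_, fun y hy => ?_, isOpen_compl_image_closedBall 0 (inv_pos.2 hε), ?_⟩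
      · rcases eq_inftyPt_or_eq_affinePt y with rfl | ⟨z, rfl⟩
        · exact hx
        · have hz : ε⁻¹ < ‖z‖ := by
            by_contra hz
            exact hy ⟨z, by simpa using hz, rfl⟩
          have hz0 : z ≠ 0 := norm_pos_iff.1 ((inv_pos.2 hε).trans hz)
          have hm : z⁻¹ ∈ Metric.ball (0 : K) ε := by
            rw [mem_ball_zero_iff, norm_inv]
            exact inv_lt_of_inv_lt₀ hε hz
          have := hb hm
          rwa [Set.mem_preimage, Set.mem_preimage, Projectivization.mk'_eq_mk,
            ← (mk_eq_affinePt_iff (z := z) _).2] at this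
          simp [hz0]
      · rintro ⟨z, -, hz⟩
        exact inftyPt_ne_affinePt z hz.symm
    · have hc : Continuous fun w : K =>
          (⟨![w, 1], by simp⟩ : {v : Fin 2 → K // v ≠ 0}) := by
        refine Continuous.subtype_mk (continuous_pi fun i => ?_) _
        fin_cases i
        exacts [continuous_id, continuous_const]
      obtain ⟨ε, hε, hb⟩ := Metric.isOpen_iff.1 (hU'.preimage hc) b hx
      exact ⟨_, Set.image_subset_iff.2 hb, isOpen_image_ball b hε,
        b, Metric.mem_ball_self hε, rfl⟩
  · have h0 : Continuous fun v : {v : Fin 2 → K // v ≠ 0} => v.1 0 :=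
      (continuous_apply 0).comp continuous_subtype_val
    have h1 : Continuous fun v : {v : Fin 2 → K // v ≠ 0} => v.1 1 :=
      (continuous_apply 1).comp continuous_subtype_val
    rintro U ⟨a, r, -, rfl | rfl⟩
    · rw [isOpen_coinduced]
      simp only [Set.preimage, mk_mem_image_ball_iff]
      exact isOpen_lt (h0.sub (continuous_const.mul h1)).norm (continuous_const.mul h1.norm)
    · rw [isOpen_coinduced]
      simp only [Set.preimage, mk_mem_compl_image_closedBall_iff]
      exact isOpen_lt (continuous_const.mul h1.norm) (h0.sub (continuous_const.mul h1)).norm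

theorem continuous_mk' :
    @Continuous _ _ inferInstance (topologyP1 K)
      (Projectivization.mk' K : {v : Fin 2 → K // v ≠ 0} → P1 K) := by
  rw [topologyP1_eq_coinduced]
  exact continuous_coinduced_rng

/-- For the quotient topology, continuity follows from that of the linear map on nonzero vectors,
with no need to compute images of balls. -/
theorem continuous_smul (g : PGL(2, K)) :
    @Continuous _ _ (topologyP1 K) (topologyP1 K) fun x : P1 K => g • x := by
  induction g using Matrix.ProjGenLinGroup.induction_on with | mk A =>
  have hA : Continuous fun v : {v : Fin 2 → K // v ≠ 0} =>
      (⟨A • v.1, (smul_ne_zero_iff_ne A).2 v.2⟩ : {v : Fin 2 → K // v ≠ 0}) := by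
    refine Continuous.subtype_mk (continuous_pi fun i => ?_) _
    have h : ∀ j, Continuous fun v : {v : Fin 2 → K // v ≠ 0} => v.1 j := fun j =>
      (continuous_apply j).comp continuous_subtype_val
    simp only [Matrix.GeneralLinearGroup.fin_two_smul]
    fin_cases i
    exacts [(continuous_const.mul (h 0)).add (continuous_const.mul (h 1)),
      (continuous_const.mul (h 0)).add (continuous_const.mul (h 1))]
  have h := (@Continuous.comp _ _ _ _ _ (topologyP1 K) _ _ continuous_mk' hA)
  rw [continuous_iff_coinduced_le]
  nth_rw 1 [topologyP1_eq_coinduced]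
  rw [coinduced_compose, ← continuous_iff_coinduced_le]
  exact h

end Topology

/-! ### Hyperbolic dynamics and accumulation of orbits. -/

section Dynamics

variable {K : Type*} [NontriviallyNormedField K]

theorem smul_mem_fixedPts {G : Subgroup PGL(2, K)} {g : PGL(2, K)} (hg : g ∈ G) {x : P1 K}
    (hx : x ∈ fixedPts G) : g • x ∈ fixedPts G := by
  obtain ⟨k, hk, hk1, hkx⟩ := hx
  refine ⟨g * k * g⁻¹, G.mul_mem (G.mul_mem hg hk) (G.inv_mem hg), fun h => hk1 ?_, ?_⟩
  · exact conj_eq_one_iff.1 h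
  · rw [mul_smul, inv_smul_smul, mul_smul, hkx]

/-- Conjugation permutes the stabilizers, and the action of `g` is continuous and injective, so it
preserves accumulation points. -/
theorem smul_mem_badPts {G : Subgroup PGL(2, K)} {g : PGL(2, K)} (hg : g ∈ G) {x : P1 K}
    (hx : x ∈ badPts G) : g • x ∈ badPts G := by
  let _ := topologyP1 K
  refine hx.imp (smul_mem_fixedPts hg) fun hx => ?_
  rw [mem_derivedSet, accPt_iff_nhds] at hx ⊢
  intro U hU
  obtain ⟨y, ⟨hyU, hy⟩, hne⟩ := hx _ ((continuous_smul g).continuousAt.preimage_mem_nhds hU)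
  exact ⟨g • y, ⟨hyU, smul_mem_fixedPts hg hy⟩, fun h => hne (MulAction.injective g h)⟩

/-- Under the powers of a linear map with two eigenvectors, all points except for that of the
smaller eigenvalue converge to that of the larger one. -/
theorem tendsto_pow_smul {A : GL (Fin 2) K} {e f : Fin 2 → K} (he : e ≠ 0) (hf : f ≠ 0)
    (hspan : ∀ v : Fin 2 → K, ∃ α β : K, v = α • e + β • f) {l m : K} (hl : A • e = l • e)
    (hm : A • f = m • f) (hlm : ‖m‖ < ‖l‖) {y : P1 K} (hy : y ≠ Projectivization.mk K f hf) :
    Filter.Tendsto (fun n : ℕ => (Matrix.ProjGenLinGroup.mk A ^ n : PGL(2, K)) • y) Filter.atTop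
      (@nhds _ (topologyP1 K) (Projectivization.mk K e he)) := by
  induction y using Projectivization.ind with | h v hv =>
  obtain ⟨α, β, rfl⟩ := hspan v
  have hα : α ≠ 0 := by
    rintro rfl
    exact hy ((Projectivization.mk_eq_mk_iff' ..).2 ⟨β, by simp⟩)
  have hl0 : l ≠ 0 := norm_pos_iff.1 ((norm_nonneg m).trans_lt hlm)
  -- Projectively the factor `α * l ^ n` is irrelevant, and the remaining representative tends to
  -- `e` because `‖m / l‖ < 1`.
  have hpow : ∀ n : ℕ, A ^ n • (α • e + β • f) = (α * l ^ n) • (e + (β / α * (m / l) ^ n) • f) := by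
    intro n
    have h1 : ∀ n : ℕ, A ^ n • e = l ^ n • e ∧ A ^ n • f = m ^ n • f := by
      intro n
      induction n with
      | zero => simp
      | succ n ih =>
        rw [pow_succ, mul_smul, mul_smul, hl, hm, smul_comm, ih.1, smul_comm _ m, ih.2, smul_smul,
          smul_smul, pow_succ', pow_succ']
        exact ⟨rfl, rfl⟩
    rw [smul_add, smul_comm _ α, smul_comm _ β, (h1 n).1, (h1 n).2, smul_add, smul_smul, smul_smul,
      smul_smul, div_pow]
    congr 2
    field_simp
  have hne : ∀ n : ℕ, e + (β / α * (m / l) ^ n) • f ≠ 0 := fun n h0 => by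
    have := (smul_ne_zero_iff_ne (A ^ n)).2 hv
    rw [hpow, h0, smul_zero] at this
    exact this rfl
  have heq : (fun n : ℕ => (Matrix.ProjGenLinGroup.mk A ^ n : PGL(2, K)) •
      Projectivization.mk K (α • e + β • f) hv) =
      fun n : ℕ => Projectivization.mk' K ⟨e + (β / α * (m / l) ^ n) • f, hne n⟩ := by
    funext n
    rw [← map_pow, Projectivization.PGL.mk_smul_mk, Projectivization.mk'_eq_mk,
      Projectivization.mk_eq_mk_iff']
    exact ⟨α * l ^ n, (hpow n).symm⟩
  rw [heq]
  let _ := topologyP1 K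
  refine (continuous_mk'.tendsto (⟨e, he⟩ : {v : Fin 2 → K // v ≠ 0})).comp ?_
  rw [tendsto_subtype_rng]
  have hq : Filter.Tendsto (fun n : ℕ => (m / l) ^ n) Filter.atTop (nhds 0) :=
    tendsto_pow_atTop_nhds_zero_of_norm_lt_one (by
      rw [norm_div]
      exact (div_lt_one (norm_pos_iff.2 hl0)).2 hlm)
  simpa using tendsto_const_nhds.add ((hq.const_mul (β / α)).smul_const f)

/-- Integer powers make the two eigenvectors interchangeable: if `e` has the smaller eigenvalue, it
attracts under `A⁻¹`. -/
theorem exists_zpow_smul_mem {A : GL (Fin 2) K} {e f : Fin 2 → K} (he : e ≠ 0) (hf : f ≠ 0)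
    (hspan : ∀ v : Fin 2 → K, ∃ α β : K, v = α • e + β • f) {l m : K} (hl : A • e = l • e)
    (hm : A • f = m • f) (hlm : ‖l‖ ≠ ‖m‖) {y : P1 K} (hy : y ≠ Projectivization.mk K f hf)
    {U : Set (P1 K)} (hU : U ∈ @nhds _ (topologyP1 K) (Projectivization.mk K e he)) :
    ∃ n : ℤ, (Matrix.ProjGenLinGroup.mk A ^ n : PGL(2, K)) • y ∈ U := by
  rcases hlm.lt_or_gt with hlt | hlt
  · have hinv : ∀ {s : K} {v : Fin 2 → K}, v ≠ 0 → A • v = s • v →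
        s ≠ 0 ∧ A⁻¹ • v = s⁻¹ • v := by
      intro s v hv h
      have hs : s ≠ 0 := by
        rintro rfl
        rw [zero_smul] at h
        exact (smul_ne_zero_iff_ne A).2 hv h
      refine ⟨hs, ?_⟩
      rw [inv_smul_eq_iff, smul_comm, h, inv_smul_smul₀ hs]
    obtain ⟨hl0, hl'⟩ := hinv he hl
    obtain ⟨hm0, hm'⟩ := hinv hf hm
    have hlt' : ‖m⁻¹‖ < ‖l⁻¹‖ := by
      rw [norm_inv, norm_inv]
      exact inv_strictAnti₀ (norm_pos_iff.2 hl0) hlt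
    obtain ⟨n, hn⟩ := ((tendsto_pow_smul he hf hspan hl' hm' hlt' hy).eventually hU).exists
    refine ⟨-n, ?_⟩
    rwa [zpow_neg, zpow_natCast, ← inv_pow, ← map_inv]
  · obtain ⟨n, hn⟩ := ((tendsto_pow_smul he hf hspan hl hm hlt hy).eventually hU).exists
    exact ⟨n, by rwa [zpow_natCast]⟩

/-- For each fixed point `x` of a hyperbolic element `g` there is a point `x'` such that all points
except for `x'` are moved arbitrarily near to `x` by the powers of `g`. -/
theorem IsHyperbolic.exists_forall_zpow_smul_mem {g : PGL(2, K)} (hg : IsHyperbolic g) {x : P1 K}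
    (hx : g • x = x) : ∃ x' : P1 K, ∀ y ≠ x', ∀ U ∈ @nhds _ (topologyP1 K) x,
      ∃ n : ℤ, g ^ n • y ∈ U := by
  obtain ⟨A, rfl, l, m, hl, hm, hlm⟩ := hg
  obtain ⟨e, hel, he⟩ := hl.exists_hasEigenvector
  obtain ⟨f, hfm, hf⟩ := hm.exists_hasEigenvector
  have hne : l ≠ m := fun h => hlm (by rw [h])
  have hAe : A • e = l • e := Module.End.mem_eigenspace_iff.1 hel
  have hAf : A • f = m • f := Module.End.mem_eigenspace_iff.1 hfm
  have hli : LinearIndependent K ![e, f] := by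
    refine LinearIndependent.pair_iff.2 fun s t hst => ?_
    have h1 : (s * l) • e + (t * m) • f = 0 := by
      have := congrArg (A • ·) hst
      simpa only [smul_add, smul_comm A, hAe, hAf, smul_zero, smul_smul] using this
    have h2 : (t * (m - l)) • f = 0 := by
      calc (t * (m - l)) • f = ((s * l) • e + (t * m) • f) - l • (s • e + t • f) := by module
        _ = 0 := by rw [h1, hst, smul_zero, sub_zero]
    have ht : t = 0 := by
      simpa [hf, sub_ne_zero.2 hne.symm] using h2
    subst ht
    simpa [he] using hst
  have hspan : ∀ v : Fin 2 → K, ∃ α β : K, v = α • e + β • f := by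
    intro v
    have hv : v ∈ Submodule.span K (Set.range ![e, f]) := by
      rw [hli.span_eq_top_of_card_eq_finrank (by simp)]
      trivial
    rw [Matrix.range_cons, Matrix.range_cons, Matrix.range_empty, Set.union_empty,
      Set.singleton_union, Submodule.mem_span_pair] at hv
    obtain ⟨α, β, h⟩ := hv
    exact ⟨α, β, h.symm⟩
  induction x using Projectivization.ind with | h v hv =>
  obtain ⟨α, β, rfl⟩ := hspan v
  rw [Projectivization.PGL.mk_smul_mk, Projectivization.mk_eq_mk_iff'] at hx
  obtain ⟨s, hs⟩ := hx
  have hs' : (α * (s - l)) • e + (β * (s - m)) • f = 0 := by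
    rw [smul_add A, smul_comm A, hAe, smul_comm A, hAf, ← sub_eq_zero] at hs
    rw [← hs]
    module
  -- Since `l ≠ m`, one of `α`, `β` vanishes: `x` is one of the two eigenlines, and the other one is
  -- the exceptional point.
  obtain ⟨h1, h2⟩ := LinearIndependent.pair_iff.1 hli _ _ hs'
  by_cases hα : α = 0
  · refine ⟨Projectivization.mk K e he, fun y hy U hU => ?_⟩
    have hx : Projectivization.mk K (α • e + β • f) hv = Projectivization.mk K f hf :=
      (Projectivization.mk_eq_mk_iff' ..).2 ⟨β, by simp [hα]⟩
    rw [hx] at hU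
    refine exists_zpow_smul_mem hf he (fun v => ?_) hAf hAe hlm.symm hy hU
    obtain ⟨α, β, rfl⟩ := hspan v
    exact ⟨β, α, add_comm _ _⟩
  · have hβ : β = 0 := by
      have hsl : s = l := by simpa [hα, sub_eq_zero] using h1
      rw [hsl] at h2
      simpa [sub_ne_zero.2 hne] using h2
    refine ⟨Projectivization.mk K f hf, fun y hy U hU => ?_⟩
    have hx : Projectivization.mk K (α • e + β • f) hv = Projectivization.mk K e he :=
      (Projectivization.mk_eq_mk_iff' ..).2 ⟨α, by simp [hβ]⟩
    rw [hx] at hU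
    exact exists_zpow_smul_mem he hf hspan hAe hAf hlm hy hU

theorem sq_sub_trace_mul_add_det_eq_zero {A : Matrix (Fin 2) (Fin 2) K} {l : K}
    (hl : Module.End.HasEigenvalue (Matrix.toLin' A) l) : l ^ 2 - A.trace * l + A.det = 0 := by
  have := (Module.End.hasEigenvalue_iff_isRoot_charpoly _ _).1 hl
  rw [Matrix.charpoly_toLin', Matrix.charpoly_fin_two] at this
  simpa using this

/-- A matrix is not hyperbolic if its determinant is the square of a nonzero eigenvalue. -/
theorem not_isHyperbolicMatrix {A : Matrix (Fin 2) (Fin 2) K} {s : K} (hs0 : s ≠ 0)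
    (hs : Module.End.HasEigenvalue (Matrix.toLin' A) s) (hdet : A.det = s ^ 2) :
    ¬ IsHyperbolicMatrix A := by
  -- The second root of the characteristic polynomial is `det / s = s`, so `s` is the only
  -- eigenvalue.
  have htr : A.trace = 2 * s := by
    refine mul_right_cancel₀ hs0 ?_
    linear_combination hdet - sq_sub_trace_mul_add_det_eq_zero hs
  have key : ∀ {l : K}, Module.End.HasEigenvalue (Matrix.toLin' A) l → l = s := fun {l} hl => by
    have h := sq_sub_trace_mul_add_det_eq_zero hl
    have h2 : (l - s) ^ 2 = 0 := by linear_combination h + l * htr - hdet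
    exact sub_eq_zero.1 (pow_eq_zero_iff two_ne_zero |>.1 h2)
  rintro ⟨l, m, hl, hm, hlm⟩
  exact hlm (by rw [key hl, key hm])

/-- A group in which all non-identity elements are hyperbolic is abelian if it fixes a point. -/
theorem IsSchottky.commute_of_forall_smul_eq {G : Subgroup PGL(2, K)} (hG : IsSchottky G)
    {x : P1 K} (hx : ∀ g ∈ G, g • x = x) {g k : PGL(2, K)} (hg : g ∈ G) (hk : k ∈ G) :
    g * k = k * g := by
  by_contra hne
  -- On the common eigenvector the scalars of the commutator cancel, and its determinant is `1`. A
  -- representative with scalar factor `u` has eigenvalue `u` and determinant `u ^ 2`, so it is not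
  -- hyperbolic.
  have hc : g * k * g⁻¹ * k⁻¹ ≠ 1 := fun h => hne (by
    rw [mul_inv_eq_one, mul_inv_eq_iff_eq_mul] at h
    exact h)
  obtain ⟨A, hA, hhyp⟩ := hG.2 _
    (G.mul_mem (G.mul_mem (G.mul_mem hg hk) (G.inv_mem hg)) (G.inv_mem hk)) hc
  have hgx := hx g hg
  have hkx := hx k hk
  clear hx hc hne
  induction g using Matrix.ProjGenLinGroup.induction_on with | mk B =>
  induction k using Matrix.ProjGenLinGroup.induction_on with | mk C =>
  induction x using Projectivization.ind with | h v hv =>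
  rw [Projectivization.PGL.mk_smul_mk, Projectivization.mk_eq_mk_iff] at hgx hkx
  obtain ⟨b, hb⟩ := hgx
  obtain ⟨c, hc⟩ := hkx
  rw [← map_mul, ← map_inv, ← map_inv, ← map_mul, ← map_mul, eq_comm,
    Matrix.ProjGenLinGroup.mk_eq_mk_iff] at hA
  obtain ⟨u, rfl⟩ := hA
  have hu : (Matrix.GeneralLinearGroup.scalar (Fin 2) u) • v = u • v := by
    simp [Units.smul_def]
  have hb' : B⁻¹ • v = b⁻¹ • v := by rw [inv_smul_eq_iff, smul_comm, ← hb, inv_smul_smul]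
  have hc' : C⁻¹ • v = c⁻¹ • v := by rw [inv_smul_eq_iff, smul_comm, ← hc, inv_smul_smul]
  refine not_isHyperbolicMatrix (s := (u : K)) u.ne_zero ?_ ?_ hhyp
  · refine Module.End.hasEigenvalue_of_hasEigenvector (x := v)
      ⟨Module.End.mem_eigenspace_iff.2 ?_, hv⟩
    change (B * C * B⁻¹ * C⁻¹ * Matrix.GeneralLinearGroup.scalar (Fin 2) u) • v = u • v
    rw [mul_smul, hu, mul_smul, smul_comm C⁻¹, hc', mul_smul, smul_comm B⁻¹, smul_comm B⁻¹, hb',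
      mul_smul, smul_comm C, smul_comm C, smul_comm C, ← hc, smul_comm B, smul_comm B, smul_comm B,
      smul_comm B, ← hb, smul_comm b⁻¹, inv_smul_smul, inv_smul_smul]
  · rw [← Matrix.GeneralLinearGroup.val_det_apply]
    simp only [map_mul, map_inv, mul_inv_cancel_comm, mul_inv_cancel, one_mul]
    simp

theorem badPts_subset_closure_orbit {G : Subgroup PGL(2, K)} (hG : IsSchottky G) {x : P1 K}
    (h : (∃ g₁ ∈ G, ∃ g₂ ∈ G, g₁ * g₂ ≠ g₂ * g₁) ∨ x ∉ badPts G) :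
    badPts G ⊆ @closure _ (topologyP1 K) (MulAction.orbit G x) := by
  let _ := topologyP1 K
  have hfix : fixedPts G ⊆ closure (MulAction.orbit G x) := by
    rintro z ⟨g, hg, hg1, hgz⟩
    obtain ⟨z', hz'⟩ := (hG.2 g hg hg1).exists_forall_zpow_smul_mem hgz
    -- Otherwise the orbit is the single point `z' = x`. A global fixed point contradicts the first
    -- alternative of `h` by commutativity, and the second because `g` fixes `x`.
    obtain ⟨k, hk, hkx⟩ : ∃ k ∈ G, k • x ≠ z' := by
      by_contra! hcon
      have hx : z' = x := by simpa using (hcon 1 G.one_mem).symm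
      subst hx
      rcases h with ⟨g₁, h₁, g₂, h₂, hne⟩ | hx
      · exact hne (hG.commute_of_forall_smul_eq hcon h₁ h₂)
      · exact hx (Or.inl ⟨g, hg, hg1, hcon g hg⟩)
    refine mem_closure_iff_nhds.2 fun U hU => ?_
    obtain ⟨n, hn⟩ := hz' _ hkx U hU
    refine ⟨_, hn, ⟨g ^ n * k, G.mul_mem (G.zpow_mem hg n) hk⟩, ?_⟩
    exact mul_smul (g ^ n) k x
  refine Set.union_subset hfix ?_
  exact (derivedSet_subset_closure _).trans (closure_minimal hfix isClosed_closure)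

end Dynamics

/-! ### Spanned subtrees depend only on closures. -/

section Subtree

variable {K : Type*} [NontriviallyNormedField K]

theorem spannedSubtree_mono {S T : Set (P1 K)} (h : S ⊆ T) :
    spannedSubtree S ⊆ spannedSubtree T :=
  Set.sdiff_subset_sdiff_left
    (Set.biUnion_mono h fun _ _ => Set.biUnion_mono h fun _ _ => subset_rfl)

variable [IsUltrametricDist K]

/-- `B(a, t)⁺` belongs to the subtree spanned by `S` if `S` has points inside and outside the open
ball of radius `t` around `a`. -/
theorem ballPt_mem_spannedSubtree {S : Set (P1 K)} {a : K} {t : ℝ} (ht : 0 < t) {x y : P1 K}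
    (hx : x ∈ S) (hy : y ∈ S) (hxa : x ∈ affinePt '' Metric.ball a t)
    (hya : y ∉ affinePt '' Metric.ball a t) : ballPt a t ht ∈ spannedSubtree S := by
  obtain ⟨b, hb, rfl⟩ := hxa
  -- Every point of an ultrametric ball is a centre, so the ball can be recentred at the point `b`
  -- where the path starts.
  have hab : ballPt a t ht = ballPt b t ht := congrArg P1an.ofBall (Subtype.ext
    (IsUltrametricDist.closedBall_eq_of_mem (Metric.ball_subset_closedBall hb)))
  refine ⟨Set.mem_biUnion hx (Set.mem_biUnion hy ?_), fun ⟨_, h⟩ => by cases h⟩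
  rw [hab]
  rcases eq_inftyPt_or_eq_affinePt y with rfl | ⟨c, rfl⟩
  · exact Or.inr (Or.inr (Or.inr (Or.inl ⟨b, rfl, rfl, t, ht, rfl⟩)))
  · refine Or.inr (Or.inr (Or.inl ⟨b, c, rfl, rfl, Or.inl ⟨t, ht, ?_, rfl⟩⟩))
    rw [IsUltrametricDist.ball_eq_of_mem hb] at hya
    by_contra! hlt
    exact hya ⟨c, by rwa [Metric.mem_ball, dist_comm, dist_eq_norm], rfl⟩

/-- The open ball about `a` and its complement are both open, so each of the two separated points
can be approximated by a point of `T` on its own side. -/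
theorem ballPt_mem_spannedSubtree_of_closure {S T : Set (P1 K)}
    (h : S ⊆ @closure _ (topologyP1 K) T) {a : K} {t : ℝ} (ht : 0 < t) {y : P1 K}
    (hx : affinePt a ∈ S) (hy : y ∈ S) (hya : y ∉ affinePt '' Metric.ball a t) :
    ballPt a t ht ∈ spannedSubtree T := by
  let _ := topologyP1 K
  obtain ⟨x', hx'a, hx'⟩ := mem_closure_iff.1 (h hx) _ (isOpen_image_ball a ht)
    ⟨a, Metric.mem_ball_self ht, rfl⟩
  obtain ⟨V, hV, hyV, hdisj⟩ : ∃ V : Set (P1 K), IsOpen V ∧ y ∈ V ∧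
      ∀ z ∈ V, z ∉ affinePt '' Metric.ball a t := by
    by_cases hyc : y ∈ affinePt '' Metric.closedBall a t
    · obtain ⟨b, hb, rfl⟩ := hyc
      -- Here `b` is at distance exactly `t` from `a`. Two open balls of the same radius are equal
      -- or disjoint, so the one about `b` avoids the one about `a`.
      refine ⟨_, isOpen_image_ball b ht, ⟨b, Metric.mem_ball_self ht, rfl⟩, ?_⟩
      rintro _ ⟨c, hc, rfl⟩ ⟨d, hd, hdc⟩
      obtain rfl := affinePt_injective hdc
      refine hya ⟨b, ?_, rfl⟩
      rw [IsUltrametricDist.ball_eq_of_mem hd, ← IsUltrametricDist.ball_eq_of_mem hc]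
      exact Metric.mem_ball_self ht
    · exact ⟨_, isOpen_compl_image_closedBall a ht, hyc, fun z hz hz' =>
        hz (Set.image_mono Metric.ball_subset_closedBall hz')⟩
  obtain ⟨y', hy'V, hy'⟩ := mem_closure_iff.1 (h hy) _ hV hyV
  exact ballPt_mem_spannedSubtree ht hx' hy' hx'a (hdisj _ hy'V)

/-- Every ball on a path separates its ends in the sense of the open ball of the same radius. Open
balls are needed for the top of the path, `t = ‖a - b‖`, whose closed ball contains both ends. -/
theorem spannedSubtree_subset_of_subset_closure {S T : Set (P1 K)}
    (h : S ⊆ @closure _ (topologyP1 K) T) : spannedSubtree S ⊆ spannedSubtree T := by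
  have hball : ∀ {a b : K} {t : ℝ}, t ≤ ‖a - b‖ → affinePt b ∉ affinePt '' Metric.ball a t := by
    rintro a b t hab ⟨c, hc, hcb⟩
    obtain rfl := affinePt_injective hcb
    rw [Metric.mem_ball, dist_comm, dist_eq_norm] at hc
    exact hc.not_ge hab
  have hinfty : ∀ {a : K} {t : ℝ}, inftyPt K ∉ affinePt '' Metric.ball a t := by
    rintro a t ⟨c, -, hc⟩
    exact inftyPt_ne_affinePt c hc.symm
  rintro P ⟨hP, hP1⟩
  simp only [Set.mem_iUnion] at hP
  obtain ⟨x, hx, y, hy, rfl | rfl | ⟨a, b, rfl, rfl, ⟨t, ht, htab, rfl⟩ | ⟨t, ht, htab, rfl⟩⟩ |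
    ⟨a, rfl, rfl, t, ht, rfl⟩ | ⟨b, rfl, rfl, t, ht, rfl⟩⟩ := hP
  · exact absurd ⟨_, rfl⟩ hP1
  · exact absurd ⟨_, rfl⟩ hP1
  · exact ballPt_mem_spannedSubtree_of_closure h ht hx hy (hball htab)
  · exact ballPt_mem_spannedSubtree_of_closure h ht hy hx (hball (norm_sub_rev a b ▸ htab))
  · exact ballPt_mem_spannedSubtree_of_closure h ht hx hy hinfty
  · exact ballPt_mem_spannedSubtree_of_closure h ht hy hx hinfty

end Subtree

end Mumford

theorem mainTheorem8 {K : Type*} [NontriviallyNormedField K] [IsUltrametricDist K]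
    [CompleteSpace K] [IsAlgClosed K]
    (G : Subgroup PGL(2, K)) (hG : Mumford.IsSchottky G) (a : K)
    (h : (∃ g₁ ∈ G, ∃ g₂ ∈ G, g₁ * g₂ ≠ g₂ * g₁) ∨ Mumford.affinePt a ∉ Mumford.badPts G) :
    Mumford.spannedSubtree (Mumford.badPts G) ⊆
        Mumford.spannedSubtree (MulAction.orbit G (Mumford.affinePt a)) ∧
      (Mumford.affinePt a ∈ Mumford.badPts G →
        Mumford.spannedSubtree (MulAction.orbit G (Mumford.affinePt a)) =
          Mumford.spannedSubtree (Mumford.badPts G)) := by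
  have hsub := Mumford.spannedSubtree_subset_of_subset_closure
    (Mumford.badPts_subset_closure_orbit hG h)
  refine ⟨hsub, fun ha => (Mumford.spannedSubtree_mono ?_).antisymm hsub⟩
  rintro _ ⟨g, rfl⟩
  exact Mumford.smul_mem_badPts g.2 ha
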